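/- Let $G=(V,E,w)$ be a finite weighted undirected graph with positive edge weights $w_{ij}=w_{ji}>0$ for $\{i,j\}\in E$ ($G$ is not assumed to be connected). Let $\mathsf P(V)$ be the set of probability vectors on $V$, and let $\mu,\nu\in\mathsf P(V)$ with $\mu\neq\nu$. Define $$\mathcal C_\infty(\mu,\nu)=\min_{\substack{\phi\in\mathbb R^V\\ \phi^T(\mu-\nu)=1}}\ \max_{\{i,j\}\in E} w_{ij}\,|\phi_i-\phi_j| ,$$ where the maximum is $0$ if $E=\varnothing$. Let $d_{w^{-1}}(i,j)\in[0,\infty]$ be the shortest-path distance in $G$ when each edge $\{k,l\}\in E$ has length $w_{kl}^{-1}$, that is, the infimum of the lengths of all walks from $i$ to $j$, with $d_{w^{-1}}(i,j)=\infty$ if $i$ and $j$ lie in different connected components. Let $$\mathcal W_{1,w^{-1}}(\mu,\nu)=\inf_{\pi}\ \sum_{i,j\in V}\pi_{ij}\,d_{w^{-1}}(i,j)\in[0,\infty],$$ where $\pi$ ranges over the couplings of $\mu$ and $\nu$ (nonnegative matrices with row sums $\mu$ and column sums $\nu$) and $0\cdot\infty=0$. Then the minimum defining $\mathcal C_\infty(\mu,\nu)$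 is attained, and $$\mathcal C_\infty(\mu,\nu)=\frac{1}{\mathcal W_{1,w^{-1}}(\mu,\nu)},$$ with the convention $1/\infty=0$. -/

import Mathlib

open scoped ENNReal

noncomputable section

namespace PConductance

variable {V : Type*}

/-- The objective `max_{ {i,j} ∈ E } w_{ij} |φ_i - φ_j|`. The darts of `G` are the oriented edges
`(i, j), (j, i)` for `{i, j} ∈ E`. For a graph without edges the value is `0`. -/
def maxEdgeVariation (G : SimpleGraph V) (w : Sym2 V → ℝ) (φ : V → ℝ) : ℝ :=
  ⨆ d : G.Dart, w d.edge * |φ d.fst - φ d.snd|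

/-- The admissible potentials: all `φ : V → ℝ` with `φᵀ (μ - ν) = 1`. -/
def admissiblePotentials [Fintype V] (μ ν : V → ℝ) : Set (V → ℝ) :=
  {φ | ∑ i, φ i * (μ i - ν i) = 1}

/-- The measure `∞`-conductance `𝒞_∞(μ, ν)`: the optimal value of the minimization of
`max_{ {i,j} ∈ E } w_{ij} |φ_i - φ_j|` over the admissible potentials. -/
def conductanceInf [Fintype V] (G : SimpleGraph V) (w : Sym2 V → ℝ) (μ ν : V → ℝ) : ℝ :=
  sInf (maxEdgeVariation G w '' admissiblePotentials μ ν)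

/-- The length of a walk in `G` when the edge `e` has length `ℓ e`. -/
def walkLength {G : SimpleGraph V} (ℓ : Sym2 V → ℝ) {u v : V} (p : G.Walk u v) : ℝ :=
  (p.edges.map ℓ).sum

/-- The shortest-path distance in `G` with nonnegative edge lengths `ℓ`. It is `∞` when no walk
joins the two vertices. -/
def shortestPathDist (G : SimpleGraph V) (ℓ : Sym2 V → ℝ) (u v : V) : ℝ≥0∞ :=
  ⨅ p : G.Walk u v, ENNReal.ofReal (walkLength ℓ p)

/-- The couplings (transport plans) of `μ` and `ν`. -/
def couplings [Fintype V] (μ ν : V → ℝ) : Set (V → V → ℝ) :=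
  {π | (∀ i j, 0 ≤ π i j) ∧ (∀ i, ∑ j, π i j = μ i) ∧ (∀ j, ∑ i, π i j = ν j)}

/-- The cost of a transport plan `π` for the ground distance `d`. In `ℝ≥0∞` one has `0 * ∞ = 0`. -/
def transportCost [Fintype V] (d : V → V → ℝ≥0∞) (π : V → V → ℝ) : ℝ≥0∞ :=
  ∑ i, ∑ j, ENNReal.ofReal (π i j) * d i j

/-- The `1`-Wasserstein distance of `μ` and `ν` for the ground distance `d`. -/
def wasserstein1 [Fintype V] (d : V → V → ℝ≥0∞) (μ ν : V → ℝ) : ℝ≥0∞ :=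
  ⨅ π ∈ couplings μ ν, transportCost d π

/-- `𝒲_{1,ℓ}(μ, ν)`: the `1`-Wasserstein distance whose ground metric is the shortest-path distance
of `G` with edge lengths `ℓ`. -/
def graphWasserstein1 [Fintype V] (G : SimpleGraph V) (ℓ : Sym2 V → ℝ) (μ ν : V → ℝ) : ℝ≥0∞ :=
  wasserstein1 (shortestPathDist G ℓ) μ ν

end PConductance

end

/-!
The identity is Kantorovich–Rubinstein duality for the shortest-path distance `d` with edge lengths
`w⁻¹`, normalized by homogeneity.

*Attainment.* The objective `maxEdgeVariation G w φ` is the sup norm of the weighted gradient of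
`φ`, which is linear in `φ`. The weighted gradients of the admissible potentials form a translate of
a linear subspace of a finite-dimensional space, hence a closed set, and a closed set has a point of
least norm (`exists_isLeast_maxEdgeVariation`). Compactness of the admissible set is not available,
since the gradient vanishes on potentials that are constant on connected components.

*Weak duality.* A potential whose weighted gradient is at most `c` satisfies
`φ u - φ v ≤ c * d u v`. Integrating this against a coupling of finite cost gives
`1 ≤ c * cost` for admissible `φ` (`one_le_mul_toReal_transportCost`). If the optimal value is `0`,
this already shows that every coupling has infinite cost.

*Strong duality.* Let the optimal value `C` be positive. By homogeneity,
`∑ φ (μ - ν) ≤ c / C` for every `φ` with weighted gradient at most `c`. The marginals and costs of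
the probability vectors on pairs at finite distance form a compact convex set. If it misses the
closed ray of all `(μ, ν, t)` with `t ≤ 1 / C`, the Hahn–Banach theorem separates the two, and the
separating functional `(a, b, -c)` is turned by the `c`-transform
`φ i = inf_j (c * d i j - b j)` into a potential that violates the bound
(`exists_coupling_transportCost_le`). So some coupling has cost at most `1 / C`.
-/

noncomputable section

namespace PConductance

variable {V : Type*}

/-! ### The objective as a norm, and its minimizer -/

/-- The weighted gradient `φ ↦ (w_{ij} (φ_i - φ_j))`, indexed by the darts of `G`. -/
def weightedGradient (G : SimpleGraph V) (w : Sym2 V → ℝ) : (V → ℝ) →ₗ[ℝ] (G.Dart → ℝ) where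
  toFun φ d := w d.edge * (φ d.fst - φ d.snd)
  map_add' φ ψ := by ext d; simp only [Pi.add_apply]; ring
  map_smul' r φ := by ext d; simp only [Pi.smul_apply, smul_eq_mul, RingHom.id_apply]; ring

lemma finite_dart [Finite V] (G : SimpleGraph V) : Finite G.Dart :=
  Finite.of_injective (fun d : G.Dart => d.toProd) fun _ _ h => SimpleGraph.Dart.ext _ _ h

lemma maxEdgeVariation_nonneg (G : SimpleGraph V) {w : Sym2 V → ℝ}
    (hw : ∀ e ∈ G.edgeSet, 0 < w e) (φ : V → ℝ) : 0 ≤ maxEdgeVariation G w φ :=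
  Real.iSup_nonneg fun d => mul_nonneg (hw _ d.edge_mem).le (abs_nonneg _)

lemma mul_abs_le_maxEdgeVariation [Finite V] (G : SimpleGraph V) (w : Sym2 V → ℝ) (φ : V → ℝ)
    {i j : V} (h : G.Adj i j) : w s(i, j) * |φ i - φ j| ≤ maxEdgeVariation G w φ := by
  have := finite_dart G
  exact le_ciSup (f := fun d : G.Dart => w d.edge * |φ d.fst - φ d.snd|)
    (Set.finite_range _).bddAbove ⟨(i, j), h⟩

lemma maxEdgeVariation_le (G : SimpleGraph V) {w : Sym2 V → ℝ} {φ : V → ℝ} {c : ℝ} (hc : 0 ≤ c)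
    (h : ∀ i j, G.Adj i j → w s(i, j) * |φ i - φ j| ≤ c) : maxEdgeVariation G w φ ≤ c :=
  Real.iSup_le (fun d => h _ _ d.adj) hc

lemma maxEdgeVariation_eq_norm (G : SimpleGraph V) [Fintype G.Dart] {w : Sym2 V → ℝ}
    (hw : ∀ e ∈ G.edgeSet, 0 < w e) (φ : V → ℝ) :
    maxEdgeVariation G w φ = ‖weightedGradient G w φ‖ := by
  have key (d : G.Dart) : ‖weightedGradient G w φ d‖ = w d.edge * |φ d.fst - φ d.snd| := by
    simp [weightedGradient, abs_of_pos (hw _ d.edge_mem)]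
  refine le_antisymm (Real.iSup_le (fun d => ?_) (norm_nonneg _)) ?_
  · rw [← key]
    exact norm_le_pi_norm _ d
  · refine (pi_norm_le_iff_of_nonneg (maxEdgeVariation_nonneg G hw φ)).2 fun d => ?_
    rw [key]
    exact le_ciSup (f := fun d : G.Dart => w d.edge * |φ d.fst - φ d.snd|)
      (Set.finite_range _).bddAbove d

lemma admissiblePotentials_nonempty [Fintype V] {μ ν : V → ℝ} (h : μ ≠ ν) :
    (admissiblePotentials μ ν).Nonempty := by
  have hpos : 0 < ∑ i, (μ i - ν i) * (μ i - ν i) := by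
    obtain ⟨i, hi⟩ := Function.ne_iff.1 h
    exact Finset.sum_pos' (fun i _ => mul_self_nonneg _)
      ⟨i, Finset.mem_univ _, mul_self_pos.2 (sub_ne_zero.2 hi)⟩
  refine ⟨fun i => (∑ i, (μ i - ν i) * (μ i - ν i))⁻¹ * (μ i - ν i), ?_⟩
  simp only [admissiblePotentials, Set.mem_ofPred_eq, mul_assoc, ← Finset.mul_sum]
  exact inv_mul_cancel₀ hpos.ne'

/-- A linear map between finite-dimensional spaces sends the level sets of a linear form to closed
sets, because they are translates of linear subspaces. -/
lemma isClosed_image_levelSet {E F : Type*} [AddCommGroup E] [Module ℝ E]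
    [NormedAddCommGroup F] [NormedSpace ℝ F] [FiniteDimensional ℝ F]
    (A : E →ₗ[ℝ] F) (f : E →ₗ[ℝ] ℝ) (r : ℝ) : IsClosed (A '' {x | f x = r}) := by
  rcases Set.eq_empty_or_nonempty {x | f x = r} with h | ⟨x₀, hx₀⟩
  · simp [h]
  · have hx₀ : f x₀ = r := hx₀
    have : A '' {x | f x = r} = Homeomorph.addLeft (A x₀) '' ((LinearMap.ker f).map A : Set F) := by
      ext y
      constructor
      · rintro ⟨x, hx, rfl⟩
        have hx : f x = r := hx
        exact ⟨A (x - x₀), ⟨x - x₀, by simp [hx, hx₀], rfl⟩, by simp⟩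
      · rintro ⟨_, ⟨x, hx, rfl⟩, rfl⟩
        have hx : f x = 0 := hx
        exact ⟨x₀ + x, by simp [hx, hx₀], by simp⟩
    rw [this]
    exact (Homeomorph.addLeft (A x₀)).isClosedMap _ (Submodule.closed_of_finiteDimensional _)

lemma exists_isLeast_maxEdgeVariation [Fintype V] (G : SimpleGraph V) {w : Sym2 V → ℝ}
    (hw : ∀ e ∈ G.edgeSet, 0 < w e) {μ ν : V → ℝ} (h : μ ≠ ν) :
    ∃ c, IsLeast (maxEdgeVariation G w '' admissiblePotentials μ ν) c := by
  have := finite_dart G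
  have := Fintype.ofFinite G.Dart
  let f : (V → ℝ) →ₗ[ℝ] ℝ := ∑ i, (μ i - ν i) • LinearMap.proj i
  have hf : admissiblePotentials μ ν = {φ | f φ = 1} := by
    ext φ
    simp [admissiblePotentials, f, mul_comm]
  have hclosed : IsClosed (weightedGradient G w '' admissiblePotentials μ ν) :=
    hf ▸ isClosed_image_levelSet _ f 1
  obtain ⟨_, ⟨φ, hφ, rfl⟩, hdist⟩ :=
    hclosed.exists_infDist_eq_dist ((admissiblePotentials_nonempty h).image _) 0
  refine ⟨_, ⟨φ, hφ, rfl⟩, ?_⟩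
  rintro _ ⟨ψ, hψ, rfl⟩
  rw [maxEdgeVariation_eq_norm G hw, maxEdgeVariation_eq_norm G hw, ← dist_zero_left,
    ← dist_zero_left, ← hdist]
  exact Metric.infDist_le_dist_of_mem ⟨ψ, hψ, rfl⟩

/-! ### Shortest-path distance and Lipschitz potentials -/

lemma sub_le_mul_walkLength {G : SimpleGraph V} {w : Sym2 V → ℝ} (hw : ∀ e ∈ G.edgeSet, 0 < w e)
    {φ : V → ℝ} {c : ℝ} (h : ∀ i j, G.Adj i j → w s(i, j) * |φ i - φ j| ≤ c) {u v : V}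
    (p : G.Walk u v) : φ u - φ v ≤ c * walkLength (fun e => (w e)⁻¹) p := by
  induction p with
  | nil => simp [walkLength]
  | @cons u x v hux p ih =>
    have h1 : φ u - φ x ≤ c * (w s(u, x))⁻¹ := by
      rw [← div_eq_mul_inv, le_div_iff₀ (hw _ hux), mul_comm]
      exact (mul_le_mul_of_nonneg_left (le_abs_self _) (hw _ hux).le).trans (h _ _ hux)
    simp only [walkLength, SimpleGraph.Walk.edges_cons, List.map_cons, List.sum_cons] at ih ⊢
    linarith

lemma walkLength_nonneg {G : SimpleGraph V} {ℓ : Sym2 V → ℝ} (hℓ : ∀ e ∈ G.edgeSet, 0 ≤ ℓ e)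
    {u v : V} (p : G.Walk u v) : 0 ≤ walkLength ℓ p := by
  refine List.sum_nonneg fun x hx => ?_
  obtain ⟨e, he, rfl⟩ := List.mem_map.1 hx
  exact hℓ e (p.edges_subset_edgeSet he)

lemma sub_le_mul_toReal_shortestPathDist {G : SimpleGraph V} {w : Sym2 V → ℝ}
    (hw : ∀ e ∈ G.edgeSet, 0 < w e) {φ : V → ℝ} {c : ℝ} (hc : 0 ≤ c)
    (h : ∀ i j, G.Adj i j → w s(i, j) * |φ i - φ j| ≤ c) {u v : V}
    (huv : shortestPathDist G (fun e => (w e)⁻¹) u v ≠ ∞) :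
    φ u - φ v ≤ c * (shortestPathDist G (fun e => (w e)⁻¹) u v).toReal := by
  have hne : Nonempty (G.Walk u v) := by
    by_contra hemp
    rw [not_nonempty_iff] at hemp
    exact huv (by simp [shortestPathDist])
  rw [shortestPathDist, ENNReal.toReal_iInf fun _ => ENNReal.ofReal_ne_top,
    Real.mul_iInf_of_nonneg hc]
  refine le_ciInf fun p => ?_
  rw [ENNReal.toReal_ofReal (walkLength_nonneg (fun e he => (inv_pos.2 (hw e he)).le) p)]
  exact sub_le_mul_walkLength hw h p

lemma shortestPathDist_self (G : SimpleGraph V) (ℓ : Sym2 V → ℝ) (u : V) :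
    shortestPathDist G ℓ u u = 0 :=
  le_antisymm ((iInf_le _ .nil).trans (by simp [walkLength])) zero_le

lemma shortestPathDist_le_add_of_adj {G : SimpleGraph V} {ℓ : Sym2 V → ℝ} {u x : V}
    (h : G.Adj u x) (v : V) :
    shortestPathDist G ℓ u v ≤ ENNReal.ofReal (ℓ s(u, x)) + shortestPathDist G ℓ x v := by
  rw [shortestPathDist, shortestPathDist, ENNReal.add_iInf]
  refine le_iInf fun p => (iInf_le _ (.cons h p)).trans ?_
  simpa [walkLength] using ENNReal.ofReal_add_le

/-- The `c`-transform: an infimum of the functions `i ↦ c * d i j + g j`, over the `j` at finite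
distance from `i`, has weighted gradient at most `c`. The constraint on `j` does not affect
continuity along an edge, because adjacent vertices are at finite distance from the same `j`. -/
lemma mul_abs_iInf_sub_iInf_le [Finite V] {G : SimpleGraph V} {w : Sym2 V → ℝ}
    (hw : ∀ e ∈ G.edgeSet, 0 < w e) {c : ℝ} (hc : 0 ≤ c) (g : V → ℝ) {d : V → V → ℝ≥0∞}
    (hd : d = shortestPathDist G fun e => (w e)⁻¹) {φ : V → ℝ}
    (hφ : ∀ i, φ i = ⨅ j : {j // d i j ≠ ∞}, (c * (d i j).toReal + g j))
    {u x : V} (h : G.Adj u x) : w s(u, x) * |φ u - φ x| ≤ c := by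
  have key : ∀ u x, G.Adj u x → φ u - φ x ≤ c * (w s(u, x))⁻¹ := by
    intro u x h
    have : Nonempty {j // d x j ≠ ∞} := ⟨x, by simp [hd, shortestPathDist_self]⟩
    rw [sub_le_comm, hφ x]
    refine le_ciInf fun ⟨j, hj⟩ => ?_
    have hle : d u j ≤ ENNReal.ofReal (w s(u, x))⁻¹ + d x j :=
      hd ▸ shortestPathDist_le_add_of_adj h j
    have hfin : ENNReal.ofReal (w s(u, x))⁻¹ + d x j ≠ ∞ :=
      ENNReal.add_ne_top.2 ⟨ENNReal.ofReal_ne_top, hj⟩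
    have hreal : (d u j).toReal ≤ (w s(u, x))⁻¹ + (d x j).toReal := by
      have := ENNReal.toReal_mono hfin hle
      rwa [ENNReal.toReal_add ENNReal.ofReal_ne_top hj,
        ENNReal.toReal_ofReal (inv_pos.2 (hw _ h)).le] at this
    have hu : φ u ≤ c * (d u j).toReal + g j := by
      rw [hφ u]
      exact ciInf_le (f := fun j : {j // d u j ≠ ∞} => c * (d u j).toReal + g j)
        (Set.finite_range _).bddBelow ⟨j, ne_top_of_le_ne_top hfin hle⟩
    have := mul_le_mul_of_nonneg_left hreal hc
    simp only
    linarith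
  have h1 := key u x h
  have h2 := key x u h.symm
  rw [Sym2.eq_swap] at h2
  rw [mul_comm, ← le_div_iff₀ (hw _ h), div_eq_mul_inv]
  exact abs_sub_le_iff.2 ⟨h1, h2⟩

/-! ### Weak duality -/

lemma toReal_transportCost [Fintype V] {d : V → V → ℝ≥0∞} {π : V → V → ℝ}
    (hπ : ∀ i j, 0 ≤ π i j) (h : transportCost d π ≠ ∞) :
    (transportCost d π).toReal = ∑ i, ∑ j, π i j * (d i j).toReal := by
  have h1 : ∀ i, ∑ j, ENNReal.ofReal (π i j) * d i j ≠ ∞ := fun i =>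
    ENNReal.sum_ne_top.1 h i (Finset.mem_univ _)
  rw [transportCost, ENNReal.toReal_sum fun i _ => h1 i]
  refine Finset.sum_congr rfl fun i _ => ?_
  rw [ENNReal.toReal_sum fun j hj => ENNReal.sum_ne_top.1 (h1 i) j hj]
  refine Finset.sum_congr rfl fun j _ => ?_
  rw [ENNReal.toReal_mul, ENNReal.toReal_ofReal (hπ i j)]

lemma sum_mul_sub_eq_of_mem_couplings [Fintype V] {μ ν : V → ℝ} {π : V → V → ℝ}
    (hπ : π ∈ couplings μ ν) (φ : V → ℝ) :
    ∑ i, φ i * (μ i - ν i) = ∑ i, ∑ j, π i j * (φ i - φ j) := by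
  have h1 : ∑ i, ∑ j, π i j * φ i = ∑ i, φ i * μ i :=
    Finset.sum_congr rfl fun i _ => by rw [← Finset.sum_mul, hπ.2.1, mul_comm]
  have h2 : ∑ i, ∑ j, π i j * φ j = ∑ j, φ j * ν j := by
    rw [Finset.sum_comm]
    exact Finset.sum_congr rfl fun i _ => by rw [← Finset.sum_mul, hπ.2.2, mul_comm]
  simp only [mul_sub, Finset.sum_sub_distrib, h1, h2]

lemma one_le_mul_toReal_transportCost [Fintype V] {G : SimpleGraph V} {w : Sym2 V → ℝ}
    (hw : ∀ e ∈ G.edgeSet, 0 < w e) {μ ν : V → ℝ} {φ : V → ℝ} (hφ : φ ∈ admissiblePotentials μ ν)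
    {π : V → V → ℝ} (hπ : π ∈ couplings μ ν)
    (hfin : transportCost (shortestPathDist G fun e => (w e)⁻¹) π ≠ ∞) :
    1 ≤ maxEdgeVariation G w φ *
      (transportCost (shortestPathDist G fun e => (w e)⁻¹) π).toReal := by
  have hφ : ∑ i, φ i * (μ i - ν i) = 1 := hφ
  rw [toReal_transportCost hπ.1 hfin, ← hφ, sum_mul_sub_eq_of_mem_couplings hπ, Finset.mul_sum]
  refine Finset.sum_le_sum fun i _ => ?_
  rw [Finset.mul_sum]
  refine Finset.sum_le_sum fun j _ => ?_
  rcases (hπ.1 i j).eq_or_lt with h0 | hpos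
  · simp [← h0]
  · have hij : shortestPathDist G (fun e => (w e)⁻¹) i j ≠ ∞ := fun htop => by
      refine ENNReal.sum_ne_top.1 (ENNReal.sum_ne_top.1 hfin i (Finset.mem_univ _)) j
        (Finset.mem_univ _) ?_
      rw [htop, ENNReal.mul_top (ENNReal.ofReal_pos.2 hpos).ne']
    rw [mul_left_comm]
    exact mul_le_mul_of_nonneg_left (sub_le_mul_toReal_shortestPathDist hw
      (maxEdgeVariation_nonneg G hw φ)
      (fun _ _ h => mul_abs_le_maxEdgeVariation G w φ h) hij) hpos.le

/-! ### Strong duality -/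

/-- The theorem of the alternative for transport plans: if no coupling has cost at most `T`, there
are dual variables `(a, b, c)`, feasible for the ground distance on the pairs at finite distance,
whose dual value exceeds `c * T`. The case `c = 0` certifies that no coupling is supported on the
pairs at finite distance. -/
lemma exists_dual_of_forall_lt_transportCost [Fintype V] {d : V → V → ℝ≥0∞} {μ ν : V → ℝ}
    (hμ : μ ∈ stdSimplex ℝ V) {T : ℝ}
    (hT : ∀ π ∈ couplings μ ν, ENNReal.ofReal T < transportCost d π) :
    ∃ (a b : V → ℝ) (c : ℝ), 0 ≤ c ∧ (∀ i j, d i j ≠ ∞ → a i + b j ≤ c * (d i j).toReal) ∧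
      c * T < ∑ i, a i * μ i + ∑ j, b j * ν j := by
  classical
  let ι := {p : V × V // d p.1 p.2 ≠ ∞}
  -- Marginals and cost of a plan that is supported on the pairs at finite distance.
  let A : (ι → ℝ) →ₗ[ℝ] (V → ℝ) × (V → ℝ) × ℝ := ∑ p : ι, (LinearMap.proj p).smulRight
    (Pi.single p.1.1 (1 : ℝ), Pi.single p.1.2 (1 : ℝ), (d p.1.1 p.1.2).toReal)
  have hA (x : ι → ℝ) : A x = ∑ p : ι, x p •
      ((Pi.single p.1.1 (1 : ℝ), Pi.single p.1.2 (1 : ℝ), (d p.1.1 p.1.2).toReal) :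
        (V → ℝ) × (V → ℝ) × ℝ) := by
    simp [A, LinearMap.sum_apply]
  have hcompact : IsCompact (A '' stdSimplex ℝ ι) :=
    (isCompact_stdSimplex ℝ ι).image A.continuous_of_finiteDimensional
  have hconvex : Convex ℝ (A '' stdSimplex ℝ ι) := (convex_stdSimplex ℝ ι).linear_image A
  let R : Set ((V → ℝ) × (V → ℝ) × ℝ) := {μ} ×ˢ {ν} ×ˢ Set.Iic T
  have hRconvex : Convex ℝ R :=
    (convex_singleton μ).prod ((convex_singleton ν).prod (convex_Iic T))
  have hRclosed : IsClosed R := isClosed_singleton.prod (isClosed_singleton.prod isClosed_Iic)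
  have hdisj : Disjoint (A '' stdSimplex ℝ ι) R := by
    rw [Set.disjoint_left]
    rintro _ ⟨x, hx, rfl⟩ ⟨h1, h2, h3⟩
    rw [hA] at h1 h2 h3
    simp only [Set.mem_singleton_iff, Set.mem_Iic] at h1 h2 h3
    let π : V → V → ℝ := fun i j => if h : d i j ≠ ∞ then x ⟨(i, j), h⟩ else 0
    have hsum (F : V → V → ℝ) :
        ∑ p : ι, x p * F p.1.1 p.1.2 = ∑ i, ∑ j, π i j * F i j := by
      have hrest : ∑ q : {q : V × V // ¬ d q.1 q.2 ≠ ∞}, π q.1.1 q.1.2 * F q.1.1 q.1.2 = 0 :=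
        Finset.sum_eq_zero fun q _ => by simp [π, not_not.1 q.2]
      rw [← Fintype.sum_prod_type' fun i j => π i j * F i j,
        ← Fintype.sum_subtype_add_sum_subtype (fun q : V × V => d q.1 q.2 ≠ ∞), hrest, add_zero]
      exact Finset.sum_congr rfl fun p _ => by simp only [π, dif_pos p.2]; rfl
    have hπ0 (i j : V) : 0 ≤ π i j := by
      simp only [π]
      split_ifs
      exacts [hx.1 _, le_rfl]
    have hπ : π ∈ couplings μ ν := by
      refine ⟨hπ0, fun i => ?_, fun j => ?_⟩
      · have := hsum fun a _ => (Pi.single a 1 : V → ℝ) i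
        rw [← h1]
        simp_all [Prod.fst_sum, Finset.sum_apply, Pi.single_apply]
      · have := hsum fun _ b => (Pi.single b 1 : V → ℝ) j
        rw [← h2]
        simp_all [Prod.fst_sum, Prod.snd_sum, Finset.sum_apply, Pi.single_apply]
    have hterm (i j : V) :
        ENNReal.ofReal (π i j) * d i j = ENNReal.ofReal (π i j * (d i j).toReal) := by
      by_cases h : d i j = ∞
      · simp [π, h]
      · rw [ENNReal.ofReal_mul (hπ0 i j), ENNReal.ofReal_toReal h]
    have hcost : transportCost d π = ENNReal.ofReal (∑ i, ∑ j, π i j * (d i j).toReal) := by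
      have hnonneg (i j : V) : 0 ≤ π i j * (d i j).toReal :=
        mul_nonneg (hπ0 i j) ENNReal.toReal_nonneg
      rw [ENNReal.ofReal_sum_of_nonneg fun i _ => Finset.sum_nonneg fun j _ => hnonneg i j]
      simp only [transportCost, hterm, ENNReal.ofReal_sum_of_nonneg fun j _ => hnonneg _ j]
    refine (hT π hπ).not_ge ?_
    rw [hcost, ← hsum fun i j => (d i j).toReal]
    refine ENNReal.ofReal_le_ofReal (le_of_eq_of_le ?_ h3)
    simp [Prod.snd_sum]
  obtain ⟨f, u, v, hfu, huv, hfv⟩ :=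
    geometric_hahn_banach_compact_closed hconvex hcompact hRconvex hRclosed hdisj
  have hrepr (x y : V → ℝ) (t : ℝ) : f (x, y, t) =
      ∑ i, f (Pi.single i 1, 0, 0) * x i + ∑ j, f (0, Pi.single j 1, 0) * y j
        + t * f (0, 0, 1) := by
    have hdecomp : (x, y, t) = ∑ i, x i • ((Pi.single i 1, 0, 0) : (V → ℝ) × (V → ℝ) × ℝ) +
        ∑ j, y j • ((0, Pi.single j 1, 0) : (V → ℝ) × (V → ℝ) × ℝ) + t • (0, 0, 1) := by
      ext k <;> simp [Prod.fst_sum, Prod.snd_sum, Finset.sum_apply, Pi.single_apply]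
    rw [hdecomp]
    simp only [map_add, map_sum, map_smul, smul_eq_mul, mul_comm]
  have hray (t : ℝ) (ht : t ≤ T) : v < f (μ, ν, t) := hfv _ ⟨rfl, rfl, ht⟩
  have hsumμ : ∑ i, μ i = 1 := hμ.2
  -- The threshold `u` is absorbed into `a`, since `μ` has total mass `1`.
  refine ⟨fun i => f (Pi.single i 1, 0, 0) - u, fun j => f (0, Pi.single j 1, 0), -f (0, 0, 1),
    ?_, fun i j hij => ?_, ?_⟩
  · -- A positive last coefficient would make `f` unbounded below on the ray.
    by_contra! hneg
    have hpos : 0 < f (0, 0, 1) := by linarith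
    have hT0 := hray T le_rfl
    have := hray (T - (f (μ, ν, T) - v) / f (0, 0, 1))
      (sub_le_self _ (div_nonneg (by linarith) hpos.le))
    rw [hrepr, sub_mul, div_mul_cancel₀ _ hpos.ne', hrepr μ ν T] at this
    linarith
  · have hmem : ((Pi.single i 1, Pi.single j 1, (d i j).toReal) : (V → ℝ) × (V → ℝ) × ℝ) ∈
        A '' stdSimplex ℝ ι := by
      refine ⟨Pi.single ⟨(i, j), hij⟩ 1, single_mem_stdSimplex _ _, ?_⟩
      rw [hA, Finset.sum_eq_single ⟨(i, j), hij⟩] <;> simp +contextual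
    have := hfu _ hmem
    rw [hrepr] at this
    simp [Pi.single_apply] at this
    linarith
  · have := hray T le_rfl
    rw [hrepr] at this
    simp only [sub_mul, Finset.sum_sub_distrib, ← Finset.mul_sum, hsumμ]
    linarith

lemma exists_coupling_transportCost_le [Fintype V] {G : SimpleGraph V} {w : Sym2 V → ℝ}
    (hw : ∀ e ∈ G.edgeSet, 0 < w e) {μ ν : V → ℝ} (hμ : μ ∈ stdSimplex ℝ V)
    (hν : ν ∈ stdSimplex ℝ V) {T : ℝ}
    (hT : ∀ (φ : V → ℝ) (c : ℝ), 0 ≤ c → (∀ i j, G.Adj i j → w s(i, j) * |φ i - φ j| ≤ c) →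
      ∑ i, φ i * (μ i - ν i) ≤ c * T) :
    ∃ π ∈ couplings μ ν,
      transportCost (shortestPathDist G fun e => (w e)⁻¹) π ≤ ENNReal.ofReal T := by
  by_contra! hlt
  obtain ⟨a, b, c, hc, hab, hval⟩ := exists_dual_of_forall_lt_transportCost hμ hlt
  set d := shortestPathDist G fun e => (w e)⁻¹ with hd
  let φ : V → ℝ := fun i => ⨅ j : {j // d i j ≠ ∞}, (c * (d i j).toReal + -b j)
  have hdself (i : V) : d i i = 0 := shortestPathDist_self _ _ _
  -- The transform dominates `a`, and `-φ` dominates `b`, so the dual value only increases.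
  have haφ (i : V) : a i ≤ φ i := by
    have : Nonempty {j // d i j ≠ ∞} := ⟨i, by simp [hdself]⟩
    refine le_ciInf fun ⟨j, hj⟩ => ?_
    have := hab i j hj
    simp only
    linarith
  have hbφ (j : V) : b j ≤ -φ j := by
    have : φ j ≤ c * (d j j).toReal + -b j :=
      ciInf_le (f := fun k : {k // d j k ≠ ∞} => c * (d j k).toReal + -b k)
        (Set.finite_range _).bddBelow ⟨j, by simp [hdself]⟩
    simp only [hdself, ENNReal.toReal_zero, mul_zero, zero_add] at this
    linarith
  have h1 : ∑ i, a i * μ i ≤ ∑ i, φ i * μ i :=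
    Finset.sum_le_sum fun i _ => mul_le_mul_of_nonneg_right (haφ i) (hμ.1 i)
  have h2 : ∑ i, b i * ν i ≤ ∑ i, -φ i * ν i :=
    Finset.sum_le_sum fun i _ => mul_le_mul_of_nonneg_right (hbφ i) (hν.1 i)
  have h3 := hT φ c hc fun u x h =>
    mul_abs_iInf_sub_iInf_le hw hc (fun j => -b j) hd (fun _ => rfl) h
  simp only [mul_sub, Finset.sum_sub_distrib, neg_mul, Finset.sum_neg_distrib] at h2 h3
  linarith

/-- The homogeneous form of optimality of `C`: rescaling `φ` to an admissible potential bounds its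
pairing with `μ - ν`. -/
lemma sum_mul_sub_le_of_isLeast [Fintype V] {G : SimpleGraph V} {w : Sym2 V → ℝ} {μ ν : V → ℝ}
    {C : ℝ} (hC : IsLeast (maxEdgeVariation G w '' admissiblePotentials μ ν) C) (hpos : 0 < C)
    {φ : V → ℝ} {c : ℝ} (hc : 0 ≤ c) (h : ∀ i j, G.Adj i j → w s(i, j) * |φ i - φ j| ≤ c) :
    ∑ i, φ i * (μ i - ν i) ≤ c * C⁻¹ := by
  set s := ∑ i, φ i * (μ i - ν i) with hs
  rcases le_or_gt s 0 with h0 | h0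
  · exact h0.trans (by positivity)
  have hle : C ≤ s⁻¹ * c := by
    refine (hC.2 ⟨fun i => s⁻¹ * φ i, ?_, rfl⟩).trans
      (maxEdgeVariation_le G (by positivity) fun i j hij => ?_)
    · simp only [admissiblePotentials, Set.mem_ofPred_eq, mul_assoc, ← Finset.mul_sum]
      exact inv_mul_cancel₀ h0.ne'
    · rw [← mul_sub, abs_mul, abs_of_pos (inv_pos.2 h0), mul_left_comm]
      exact mul_le_mul_of_nonneg_left (h i j hij) (by positivity)
  rwa [← div_eq_mul_inv, le_div_iff₀ hpos, ← le_inv_mul_iff₀ h0]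

end PConductance

end

theorem mainTheorem4 {V : Type*} [Fintype V] (G : SimpleGraph V) (w : Sym2 V → ℝ)
    (hw : ∀ e ∈ G.edgeSet, 0 < w e) (μ ν : V → ℝ)
    (hμ : μ ∈ stdSimplex ℝ V) (hν : ν ∈ stdSimplex ℝ V) (hμν : μ ≠ ν) :
    IsLeast (PConductance.maxEdgeVariation G w '' PConductance.admissiblePotentials μ ν)
        (PConductance.conductanceInf G w μ ν) ∧
      ENNReal.ofReal (PConductance.conductanceInf G w μ ν) =
        1 / PConductance.graphWasserstein1 G (fun e => (w e)⁻¹) μ ν := by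
  obtain ⟨C, hC⟩ := PConductance.exists_isLeast_maxEdgeVariation G hw hμν
  have hCeq : PConductance.conductanceInf G w μ ν = C := hC.csInf_eq
  rw [hCeq, one_div]
  refine ⟨hC, le_antisymm ?_ ?_⟩
  · rw [ENNReal.le_inv_iff_le_inv]
    rcases le_or_gt C 0 with h0 | hpos
    · simp [ENNReal.ofReal_of_nonpos h0]
    · obtain ⟨π, hπ, hle⟩ := PConductance.exists_coupling_transportCost_le hw hμ hν
        fun φ c hc h => PConductance.sum_mul_sub_le_of_isLeast hC hpos hc h
      rw [← ENNReal.ofReal_inv_of_pos hpos]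
      exact (iInf₂_le π hπ).trans hle
  · rw [ENNReal.inv_le_iff_inv_le]
    refine le_iInf₂ fun π hπ => ?_
    obtain ⟨φ, hφ, rfl⟩ := hC.1
    rcases eq_or_ne (PConductance.transportCost
      (PConductance.shortestPathDist G fun e => (w e)⁻¹) π) ∞ with htop | hfin
    · simp [htop]
    have h1 := PConductance.one_le_mul_toReal_transportCost hw hφ hπ hfin
    have hpos : 0 < PConductance.maxEdgeVariation G w φ :=
      (PConductance.maxEdgeVariation_nonneg G hw φ).lt_of_ne fun h => by
        rw [← h, zero_mul] at h1
        exact absurd h1 (by norm_num)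
    rw [← ENNReal.ofReal_inv_of_pos hpos, ENNReal.ofReal_le_iff_le_toReal hfin,
      inv_le_iff_one_le_mul₀' hpos]
    exact h1
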